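/- **Definitions.** For a string $w$ over a finite ordered alphabet let $w\$$ be $w$ followed by an end-marker $\$$ smaller than every letter. A *right-extension* of a string $v$ is a string $xa$ ($a$ a letter) such that $xa$ and $xb$ both occur in $v$ for some letter $b\neq a$; a set $S$ of positions of $v$ is *suffixient* if every right-extension of $v$ is a suffix of $v[0..j]$ for some $j\in S$. Let $\chi$ be the smallest size of a suffixient set of $w\$$, and let $r$ be the number of runs (maximal blocks of equal letters) of the Burrows–Wheeler transform of $w\$$, i.e. of the last column of the matrix whose rows are all rotations of $w\$$ in lexicographic order. For $k\ge 2$ let $T_k(x)=x^k+x+1\in\mathbb F_2[x]$; it is *primitive* if it is irreducible and the class of $x$ in $\mathbb F_2[x]/(T_k)$ has multiplicative order $2^k-1$. Let $F(x_0,\dots,x_{k-1})=(x_1,\dots,x_{k-1},x_0+x_1)$ be the successor map on $\mathbb F_2^k$ of the linear-feedback shift register with characteristic polynomial $T_k$, and let $F'$ be obtained from $F$ by interchanging the successors of the states $0^k$ and $10^{k-1}$. Starting from any state $x$, let $s_t$ be the first bit of $F'^{\,t}(x)$, and let $M_k$ be the cyclic binary word of length $2^k$ obtained from $s_0s_1\cdots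 s_{2^k-1}$ by reversing it and complementing every bit. For a rotation $U$ of $M_k$, let $U_{\mathrm{lin}}$ be $U$ followed by its first $k-1$ letters. **Theorem.** Let $k\ge 2$ be such that $T_k$ is primitive over $\mathbb F_2$. For every initial state, $M_k$ has exactly one rotation $U$ that starts with $0^k$, and for the string $U_{\mathrm{lin}}\$$ over the alphabet $\$<0<1$ $$\chi=2^k+1,\qquad r=2^{k-1}+4,\qquad \frac{\chi}{r}=\frac{2^k+1}{2^{k-1}+4}.$$ The expression $(2^k+1)/(2^{k-1}+4)$ tends to $2$ as $k\to\infty$. The ratio $\chi/r$ of $U_{\mathrm{lin}}\$$ tends to $2$ as $k$ grows through the set of those $k\ge2$ for which $T_k$ is primitive (for any choice of the initial states). This last limit is meaningful (taken along a proper filter, rather than vacuous) if and only if that set of $k$ is infinite, which is not known. -/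

import Mathlib

open Filter Topology

namespace RunMinimal

section Strings

variable {α : Type*}

/-- Right-extensions of `w`: the strings `xa` such that `xa` and `xb` occur in `w` as
(contiguous) substrings for some letter `b ≠ a`. -/
def rightExtensions (w : List α) : Set (List α) :=
  {y | ∃ (x : List α) (a b : α), y = x ++ [a] ∧ b ≠ a ∧ (x ++ [a]) <:+: w ∧ (x ++ [b]) <:+: w}

/-- A set `S` of (0-based) positions of `w` is suffixient if every right-extension of `w` is a
suffix of `w[0..j]` for some `j ∈ S`. -/
def IsSuffixient (w : List α) (S : Finset ℕ) : Prop :=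
  (∀ j ∈ S, j < w.length) ∧ ∀ y ∈ rightExtensions w, ∃ j ∈ S, y <:+ w.take (j + 1)

/-- The set of all positions is suffixient, so the infimum in `suffixientSize` is attained. -/
theorem exists_isSuffixient (w : List α) : ∃ S : Finset ℕ, IsSuffixient w S := by
  refine ⟨Finset.range w.length, fun j hj => Finset.mem_range.1 hj, ?_⟩
  rintro y ⟨x, a, b, rfl, -, ⟨p, q, h⟩, -⟩
  refine ⟨p.length + x.length, ?_, p, ?_⟩
  · rw [Finset.mem_range, ← h]
    simp only [List.length_append, List.length_singleton]
    omega
  · rw [← h]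
    have : p.length + x.length + 1 = (p ++ (x ++ [a])).length := by
      simp only [List.length_append, List.length_singleton]
      omega
    rw [this, List.take_left']
    rfl

/-- The size of a smallest suffixient set of the string `w`. -/
noncomputable def suffixientSize (w : List α) : ℕ :=
  sInf {n | ∃ S : Finset ℕ, IsSuffixient w S ∧ S.card = n}

/-- The terminated string `w$`; the end-marker `$` is `⊥`, smaller than every letter. -/
def terminate (w : List α) : List (WithBot α) :=
  w.map (fun a => (a : WithBot α)) ++ [⊥]

/-- `χ(w)`: the size of a smallest suffixient set of `w$`. -/
noncomputable def chi (w : List α) : ℕ := suffixientSize (terminate w)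

/-- The number of runs (maximal blocks of equal letters) of a string. -/
def numRuns [DecidableEq α] (L : List α) : ℕ := (L.splitBy (fun a b => decide (a = b))).length

/-- The rows of the Burrows-Wheeler matrix of `v`: all cyclic rotations of `v`, sorted
lexicographically. -/
def bwMatrix [LinearOrder α] (v : List α) : List (List α) :=
  ((List.range v.length).map (fun i => v.rotate i)).mergeSort (fun x y => decide (x ≤ y))

/-- The Burrows-Wheeler transform of `w$`: the last column of the matrix of `w$`. All rows are
non-empty, so the default value in `getLastD` is never used. -/
def bwt [LinearOrder α] (w : List α) : List (WithBot α) :=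
  (bwMatrix (terminate w)).map (fun row => row.getLastD ⊥)

/-- `r(w)`: the number of runs in the Burrows-Wheeler transform of `w$`. -/
def bwtRuns [LinearOrder α] (w : List α) : ℕ := numRuns (bwt w)

/-- Linearization of order `k`: append to `U` its first `k - 1` letters. -/
def linearize (k : ℕ) (U : List α) : List α := U ++ U.take (k - 1)

end Strings

section ShiftRegisters

open Polynomial

/-- `C` is primitive over `𝔽₂`: it is irreducible and the class of `x` in `𝔽₂[x]/(C)` has
multiplicative order `2 ^ deg C - 1`. -/
def IsPrimitiveF2 (C : (ZMod 2)[X]) : Prop :=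
  Irreducible C ∧ orderOf (AdjoinRoot.root C) = 2 ^ C.natDegree - 1

/-- The trinomial `x ^ k + x + 1` over `𝔽₂`. -/
noncomputable def trinomial (k : ℕ) : (ZMod 2)[X] := X ^ k + X + 1

/-- The degrees `k ≥ 2` for which `x ^ k + x + 1` is primitive over `𝔽₂`. -/
def primitiveDegrees : Set ℕ := {k | 2 ≤ k ∧ IsPrimitiveF2 (trinomial k)}

/-- Successor map of the LFSR (Fibonacci form) with characteristic polynomial
`C = x ^ k + c_{k-1} x ^ (k-1) + ⋯ + c_0`:
`(x_0, …, x_{k-1}) ↦ (x_1, …, x_{k-1}, ∑ i, c_i x_i)`. -/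
noncomputable def lfsrNext (C : (ZMod 2)[X]) (k : ℕ) (x : Fin k → ZMod 2) : Fin k → ZMod 2 :=
  fun i => if h : (i : ℕ) + 1 < k then x ⟨i + 1, h⟩ else ∑ j : Fin k, C.coeff j * x j

/-- Interchange the successors of the states `u` and `v`. -/
def joinCycles {k : ℕ} (F : (Fin k → ZMod 2) → (Fin k → ZMod 2)) (u v : Fin k → ZMod 2) :
    (Fin k → ZMod 2) → (Fin k → ZMod 2) :=
  fun x => if x = u then F v else if x = v then F u else F x

/-- The state `1 0 ^ (k - 1)`. -/
def oneZeros (k : ℕ) : Fin k → ZMod 2 := fun i => if (i : ℕ) = 0 then 1 else 0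

/-- The LFSR of `x ^ k + x + 1`, with its main cycle and the loop at `0 ^ k` joined along the
conjugate pair `(0 ^ k, 1 0 ^ (k - 1))`. -/
noncomputable def joinedNext (k : ℕ) : (Fin k → ZMod 2) → (Fin k → ZMod 2) :=
  joinCycles (lfsrNext (trinomial k) k) 0 (oneZeros k)

/-- The bits `0, 1` of `𝔽₂` as letters of the ordered alphabet `0 < 1`. -/
def toLetter (a : ZMod 2) : Fin 2 := if a = 0 then 0 else 1

/-- The complement of a binary letter. -/
def complement (a : Fin 2) : Fin 2 := if a = 0 then 1 else 0

/-- The first bit of a state (for `k = 0` there is none, and the value is irrelevant). -/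
def firstBit {k : ℕ} (x : Fin k → ZMod 2) : Fin 2 :=
  if h : 0 < k then toLetter (x ⟨0, h⟩) else 0

/-- The word `s_0 s_1 ⋯ s_{2^k - 1}` put out by the joined register from the initial state
`seed`: `s_t` is the first bit of the state at time `t`. -/
noncomputable def joinedWord (k : ℕ) (seed : Fin k → ZMod 2) : List (Fin 2) :=
  (List.range (2 ^ k)).map (fun t => firstBit ((joinedNext k)^[t] seed))

/-- The cyclic word `M_k`: the reversed and complemented output of the joined register. -/
noncomputable def runMinimal (k : ℕ) (seed : Fin k → ZMod 2) : Cycle (Fin 2) :=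
  (((joinedWord k seed).reverse.map complement : List (Fin 2)) : Cycle (Fin 2))

/-- `U` is a rotation of `M_k` that starts with `0 ^ k`. -/
def IsZeroRotation (k : ℕ) (seed : Fin k → ZMod 2) (U : List (Fin 2)) : Prop :=
  (U : Cycle (Fin 2)) = runMinimal k seed ∧ List.replicate k 0 <+: U

end ShiftRegisters

end RunMinimal

namespace RunMinimal

open Polynomial

/-! The successor map `F` satisfies `F^k = F + 1`, so `T_k` annihilates it, and primitivity makes
the nonzero states a single cycle of length `2^k - 1`. Exchanging two successors inserts `0^k` into
that cycle, so every window of length `k` occurs exactly once in the cyclic word. Reversal turns the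
feedback rule into a rule for the letter preceding a window (`isJoinedDeBruijn_joinedWord`).

For `χ` only the window property matters (`chi_linearize`). Repeated factors have length below `k`,
so right-extensions have length at most `k`. Conversely, the `2^k` binary windows and the one ending
in the end-marker are distinct right-extensions of equal length, and each needs its own position.

For `r` (`bwtRuns_linearize`), the sorted rows begin with `0^j$` for `j < k`, then with the windows
in order of binary value `b`. The letter before a window depends on `b mod 4` in the pattern
`1,0,0,1`, flipped at the two largest values. Over `b = 1, …, 2^k - 1` this gives `2^(k-1) + 1`
runs; the earlier rows contribute `0^(k-1)`, `1` and `$`, three more. -/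

/-! ### The shift register of the trinomial and its periods. -/

theorem lfsrNext_of_lt (C : (ZMod 2)[X]) {k : ℕ} (x : Fin k → ZMod 2) {i : ℕ} (h : i + 1 < k) :
    lfsrNext C k x ⟨i, by omega⟩ = x ⟨i + 1, h⟩ := by
  simp [lfsrNext, h]

theorem trinomial_coeff {k j : ℕ} (hj : j < k) :
    (trinomial k).coeff j = (if j = 0 then 1 else 0) + (if j = 1 then 1 else 0) := by
  simp only [trinomial, coeff_add, coeff_X_pow, coeff_X, coeff_one, hj.ne, if_false, zero_add]
  rw [add_comm]
  simp only [eq_comm]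

theorem lfsrNext_trinomial_last {k : ℕ} (hk : 2 ≤ k) (x : Fin k → ZMod 2) :
    lfsrNext (trinomial k) k x ⟨k - 1, by omega⟩ = x ⟨0, by omega⟩ + x ⟨1, by omega⟩ := by
  have h : ¬ (k - 1 + 1 < k) := by omega
  rw [lfsrNext, dif_neg h]
  have : ∀ j : Fin k, (trinomial k).coeff j * x j =
      (if j = ⟨0, by omega⟩ then x j else 0) + (if j = ⟨1, by omega⟩ then x j else 0) := by
    intro j
    rw [trinomial_coeff j.2]
    split_ifs <;> simp_all [Fin.ext_iff]
  simp [this, Finset.sum_add_distrib]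

/-- The successor map of a linear-feedback shift register, as a linear map. -/
noncomputable def lfsrLinear (C : (ZMod 2)[X]) (k : ℕ) :
    (Fin k → ZMod 2) →ₗ[ZMod 2] (Fin k → ZMod 2) where
  toFun := lfsrNext C k
  map_add' x y := by
    funext i
    by_cases h : (i : ℕ) + 1 < k
    · simp [lfsrNext, h]
    · simp [lfsrNext, h, mul_add, Finset.sum_add_distrib]
  map_smul' c x := by
    funext i
    by_cases h : (i : ℕ) + 1 < k
    · simp [lfsrNext, h]
    · simp only [lfsrNext, h, dif_neg, not_false_iff, Pi.smul_apply, smul_eq_mul,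
        RingHom.id_apply, Finset.mul_sum]
      exact Finset.sum_congr rfl fun j _ => by ring

@[simp] theorem lfsrLinear_apply (C : (ZMod 2)[X]) (k : ℕ) (x : Fin k → ZMod 2) :
    lfsrLinear C k x = lfsrNext C k x := rfl

theorem lfsrLinear_pow_apply (C : (ZMod 2)[X]) (k n : ℕ) (x : Fin k → ZMod 2) :
    (lfsrLinear C k ^ n) x = (lfsrNext C k)^[n] x := by
  rw [Module.End.pow_apply]; rfl

/-- Iterates of a shift map read off later output bits. -/
theorem iterate_shift_apply {k : ℕ} {G : (Fin k → ZMod 2) → (Fin k → ZMod 2)}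
    (hG : ∀ x i (h : i + 1 < k), G x ⟨i, by omega⟩ = x ⟨i + 1, h⟩) (x : Fin k → ZMod 2)
    (t i : ℕ) (hi : i < k) : G^[t] x ⟨i, hi⟩ = G^[t + i] x ⟨0, by omega⟩ := by
  induction i generalizing t with
  | zero => rfl
  | succ i ih =>
    rw [← hG (G^[t] x) i hi, ← Function.iterate_succ_apply' G, ih (t + 1) (by omega),
      show t + 1 + i = t + (i + 1) by omega]

/-- In terms of output bits this is the recurrence `s_{t+k} = s_t + s_{t+1}`, read at time `i` for
coordinate `i`. -/
theorem lfsrNext_trinomial_iterate {k : ℕ} (hk : 2 ≤ k) (x : Fin k → ZMod 2) :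
    (lfsrNext (trinomial k) k)^[k] x = x + lfsrNext (trinomial k) k x := by
  set G := lfsrNext (trinomial k) k with hGdef
  have hG : ∀ x i (h : i + 1 < k), G x ⟨i, by omega⟩ = x ⟨i + 1, h⟩ :=
    fun x i h => lfsrNext_of_lt _ x h
  funext ⟨i, hi⟩
  have h1 := lfsrNext_trinomial_last hk (G^[i] x)
  rw [← hGdef, ← Function.iterate_succ_apply' G, iterate_shift_apply hG, iterate_shift_apply hG,
    iterate_shift_apply hG (i := 1), Nat.add_zero] at h1
  rw [iterate_shift_apply hG, Pi.add_apply]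
  have h2 := iterate_shift_apply hG x 0 i hi
  have h3 := iterate_shift_apply hG x 1 i hi
  simp only [Function.iterate_zero, id_eq, Function.iterate_one, zero_add] at h2 h3
  rw [h2, h3, add_comm 1 i, ← h1, show i.succ + (k - 1) = k + i by omega]

theorem aeval_lfsrLinear_trinomial {k : ℕ} (hk : 2 ≤ k) :
    aeval (lfsrLinear (trinomial k) k) (trinomial k) = 0 := by
  refine LinearMap.ext fun x => ?_
  have h2 : ∀ y : Fin k → ZMod 2, y + y = 0 := fun y => by
    funext i; exact CharTwo.add_self_eq_zero _
  nth_rewrite 2 [trinomial]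
  simp only [map_add, map_pow, aeval_X, map_one, LinearMap.add_apply]
  rw [lfsrLinear_pow_apply, lfsrNext_trinomial_iterate hk]
  simp only [lfsrLinear_apply, Module.End.one_apply, LinearMap.zero_apply]
  rw [show ∀ a b : Fin k → ZMod 2, a + b + b + a = (a + a) + (b + b) by intro a b; abel]
  simp [h2]

theorem natDegree_trinomial {k : ℕ} (hk : 2 ≤ k) : (trinomial k).natDegree = k := by
  have : trinomial k = X ^ k + (X + C 1) := by simp [trinomial, add_assoc]
  rw [this, natDegree_add_eq_left_of_natDegree_lt, natDegree_X_pow]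
  rw [natDegree_X_add_C, natDegree_X_pow]; omega

/-- If `T_k` did not divide `X^a - 1`, irreducibility would give a Bézout identity `1 = pT_k + q(X^a
- 1)`. Evaluated at the register and applied to `x`, both terms vanish, forcing `x = 0`. -/
theorem dvd_of_lfsrNext_iterate_eq {k : ℕ} (hk : 2 ≤ k) (hT : IsPrimitiveF2 (trinomial k))
    {x : Fin k → ZMod 2} (hx : x ≠ 0) {a : ℕ}
    (h : (lfsrNext (trinomial k) k)^[a] x = x) : 2 ^ k - 1 ∣ a := by
  obtain ⟨hirr, hord⟩ := hT
  rw [natDegree_trinomial hk] at hord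
  rw [← hord, orderOf_dvd_iff_pow_eq_one, ← sub_eq_zero]
  have : AdjoinRoot.root (trinomial k) ^ a - 1 = AdjoinRoot.mk (trinomial k) (X ^ a - 1) := by simp
  rw [this, AdjoinRoot.mk_eq_zero]
  by_contra hd
  obtain ⟨p, q, hpq⟩ := hirr.coprime_iff_not_dvd.2 hd
  apply hx
  have e := congrArg (fun r => aeval (lfsrLinear (trinomial k) k) r x) hpq
  simp only [map_add, map_mul, aeval_lfsrLinear_trinomial hk, mul_zero, zero_add, map_sub,
    map_pow, aeval_X, map_one, Module.End.mul_apply, LinearMap.sub_apply,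
    lfsrLinear_pow_apply, Module.End.one_apply, h, sub_self, map_zero] at e
  exact e.symm

theorem lfsrNext_trinomial_period {k : ℕ} (hk : 2 ≤ k) (hT : IsPrimitiveF2 (trinomial k))
    (x : Fin k → ZMod 2) : (lfsrNext (trinomial k) k)^[2 ^ k - 1] x = x := by
  have hord := hT.2
  rw [natDegree_trinomial hk] at hord
  have h0 := orderOf_dvd_iff_pow_eq_one.1 hord.dvd
  have h1 : trinomial k ∣ X ^ (2 ^ k - 1) - 1 := by
    rw [← AdjoinRoot.mk_eq_zero]; simp [h0]
  obtain ⟨q, hq⟩ := h1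
  have e := congrArg (fun r => aeval (lfsrLinear (trinomial k) k) r x) hq
  simp only [map_mul, aeval_lfsrLinear_trinomial hk, zero_mul, map_sub,
    map_pow, aeval_X, map_one, LinearMap.sub_apply,
    lfsrLinear_pow_apply, Module.End.one_apply, LinearMap.zero_apply] at e
  exact sub_eq_zero.1 e

/-! ### The joined register is a single cycle. -/

theorem oneZeros_ne_zero {k : ℕ} (hk : 2 ≤ k) : oneZeros k ≠ 0 := fun h => by
  simpa [oneZeros] using congrFun h ⟨0, by omega⟩

theorem lfsrNext_zero (C : (ZMod 2)[X]) (k : ℕ) : lfsrNext C k 0 = 0 :=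
  (lfsrLinear C k).map_zero

theorem joinedNext_zero (k : ℕ) : joinedNext k 0 = lfsrNext (trinomial k) k (oneZeros k) := by
  simp [joinedNext, joinCycles]

theorem joinedNext_oneZeros {k : ℕ} (hk : 2 ≤ k) : joinedNext k (oneZeros k) = 0 := by
  simp [joinedNext, joinCycles, oneZeros_ne_zero hk, lfsrNext_zero]

theorem joinedNext_of_ne {k : ℕ} {x : Fin k → ZMod 2} (h0 : x ≠ 0) (h1 : x ≠ oneZeros k) :
    joinedNext k x = lfsrNext (trinomial k) k x := by
  simp [joinedNext, joinCycles, h0, h1]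

/-- The two exchanged states differ only in their first bit, which the shift discards, so the
exchange affects only the incoming bit. -/
theorem joinedNext_of_lt {k : ℕ} (x : Fin k → ZMod 2) {i : ℕ} (h : i + 1 < k) :
    joinedNext k x ⟨i, by omega⟩ = x ⟨i + 1, h⟩ := by
  have hk : 2 ≤ k := by omega
  by_cases h0 : x = 0
  · subst h0
    rw [joinedNext_zero, lfsrNext_of_lt _ _ h]; simp [oneZeros]
  by_cases h1 : x = oneZeros k
  · subst h1
    rw [joinedNext_oneZeros hk]; simp [oneZeros]
  · rw [joinedNext_of_ne h0 h1, lfsrNext_of_lt _ _ h]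

theorem joinedNext_last {k : ℕ} (hk : 2 ≤ k) (x : Fin k → ZMod 2)
    [Decidable (∀ i : Fin k, (i : ℕ) ≠ 0 → x i = 0)] :
    joinedNext k x ⟨k - 1, by omega⟩ = x ⟨0, by omega⟩ + x ⟨1, by omega⟩ +
      if ∀ i : Fin k, (i : ℕ) ≠ 0 → x i = 0 then 1 else 0 := by
  by_cases h0 : x = 0
  · subst h0
    rw [joinedNext_zero, lfsrNext_trinomial_last hk]; simp [oneZeros]
  by_cases h1 : x = oneZeros k
  · subst h1
    rw [joinedNext_oneZeros hk, if_pos (by intro i hi; simp [oneZeros, hi])]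
    simp [oneZeros]; rfl
  · rw [joinedNext_of_ne h0 h1, lfsrNext_trinomial_last hk, if_neg, add_zero]
    intro h
    have hx : ∀ a : ZMod 2, a = 0 ∨ a = 1 := by decide
    rcases hx (x ⟨0, by omega⟩) with e | e
    · exact h0 (funext fun i => by
        by_cases hi : (i : ℕ) = 0
        · have : i = ⟨0, by omega⟩ := Fin.ext hi
          rw [this, e]; rfl
        · exact h i hi)
    · exact h1 (funext fun i => by
        by_cases hi : (i : ℕ) = 0
        · have : i = ⟨0, by omega⟩ := Fin.ext hi
          rw [this, e]; rfl
        · rw [h i hi]; simp [oneZeros, hi])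

/-- From `0` the joined register enters the main cycle just after `10^(k-1)`. It follows `F` as long
as it meets neither exchanged state: `0` is a fixed point off the main cycle, and the return to
`10^(k-1)` takes `2^k - 1` steps. -/
theorem joinedNext_iterate_zero {k : ℕ} (hk : 2 ≤ k) (hT : IsPrimitiveF2 (trinomial k)) (j : ℕ)
    (hj : j + 1 < 2 ^ k) :
    (joinedNext k)^[j + 1] 0 = (lfsrNext (trinomial k) k)^[j + 1] (oneZeros k) := by
  induction j with
  | zero => exact joinedNext_zero k
  | succ j ih =>
    rw [Function.iterate_succ_apply', ih (by omega), Function.iterate_succ_apply' _ (j + 1)]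
    apply joinedNext_of_ne
    · intro h
      have := lfsrNext_trinomial_period hk hT (oneZeros k)
      rw [show 2 ^ k - 1 = (2 ^ k - 1 - (j + 1)) + (j + 1) by omega, Function.iterate_add_apply, h,
        Function.iterate_fixed (lfsrNext_zero _ _)] at this
      exact oneZeros_ne_zero hk this.symm
    · intro h
      have := Nat.le_of_dvd (by omega) (dvd_of_lfsrNext_iterate_eq hk hT (oneZeros_ne_zero hk) h)
      omega

theorem joinedNext_iterate_zero_eq {k : ℕ} (hk : 2 ≤ k) (hT : IsPrimitiveF2 (trinomial k)) :
    (joinedNext k)^[2 ^ k] 0 = 0 := by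
  have h4 : 2 ^ 2 ≤ 2 ^ k := Nat.pow_le_pow_right (by omega) hk
  have h := joinedNext_iterate_zero hk hT (2 ^ k - 2) (by omega)
  rw [show 2 ^ k - 2 + 1 = 2 ^ k - 1 by omega, lfsrNext_trinomial_period hk hT] at h
  rw [show 2 ^ k = (2 ^ k - 1) + 1 by omega, Function.iterate_succ_apply', h,
    joinedNext_oneZeros hk]

theorem exists_joinedNext_iterate_zero {k : ℕ} (hk : 2 ≤ k) (hT : IsPrimitiveF2 (trinomial k))
    (y : Fin k → ZMod 2) : ∃ t < 2 ^ k, (joinedNext k)^[t] 0 = y := by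
  set f : ℕ → (Fin k → ZMod 2) := fun t => (joinedNext k)^[t] 0
  have hinj : Set.InjOn f (Finset.range (2 ^ k)) := by
    have key : ∀ a b, a < b → b < 2 ^ k → f a ≠ f b := by
      intro a b hab hb h
      rcases a with _ | a
      · have h' : (joinedNext k)^[b] 0 = 0 := h.symm
        have hs := joinedNext_iterate_zero hk hT (b - 1) (by omega)
        rw [show b - 1 + 1 = b by omega, h'] at hs
        have := lfsrNext_trinomial_period hk hT (oneZeros k)
        rw [show 2 ^ k - 1 = (2 ^ k - 1 - b) + b by omega, Function.iterate_add_apply, ← hs,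
          Function.iterate_fixed (lfsrNext_zero _ _)] at this
        exact oneZeros_ne_zero hk this.symm
      · have ha := joinedNext_iterate_zero hk hT a (by omega)
        have hs := joinedNext_iterate_zero hk hT (b - 1) (by omega)
        rw [show b - 1 + 1 = b by omega] at hs
        have h' : (joinedNext k)^[a + 1] 0 = (joinedNext k)^[b] 0 := h
        rw [ha, hs] at h'
        -- Completing one full period on the left leaves `F^(b-(a+1))` fixing `10^(k-1)`, with an
        -- exponent strictly between `0` and `2^k - 1`.
        have h'' := congrArg ((lfsrNext (trinomial k) k)^[2 ^ k - 1 - (a + 1)]) h'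
        rw [← Function.iterate_add_apply, ← Function.iterate_add_apply,
          show 2 ^ k - 1 - (a + 1) + (a + 1) = 2 ^ k - 1 by omega,
          show 2 ^ k - 1 - (a + 1) + b = (b - (a + 1)) + (2 ^ k - 1) by omega,
          Function.iterate_add_apply, lfsrNext_trinomial_period hk hT] at h''
        have := Nat.le_of_dvd (by omega)
          (dvd_of_lfsrNext_iterate_eq hk hT (oneZeros_ne_zero hk) h''.symm)
        omega
    intro a ha b hb h
    simp only [Finset.coe_range, Set.mem_Iio] at ha hb
    rcases lt_trichotomy a b with hab | hab | hab
    · exact absurd h (key a b hab hb)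
    · exact hab
    · exact absurd h.symm (key b a hab ha)
  have himg : (Finset.range (2 ^ k)).image f = Finset.univ := by
    rw [← Finset.card_eq_iff_eq_univ, Finset.card_image_of_injOn hinj]
    simp [ZMod.card]
  have := Finset.mem_univ y
  rw [← himg, Finset.mem_image] at this
  obtain ⟨t, ht, e⟩ := this
  exact ⟨t, Finset.mem_range.1 ht, e⟩

theorem joinedNext_iterate_period {k : ℕ} (hk : 2 ≤ k) (hT : IsPrimitiveF2 (trinomial k))
    (x : Fin k → ZMod 2) : (joinedNext k)^[2 ^ k] x = x := by
  obtain ⟨a, -, rfl⟩ := exists_joinedNext_iterate_zero hk hT x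
  rw [← Function.iterate_add_apply, add_comm, Function.iterate_add_apply,
    joinedNext_iterate_zero_eq hk hT]

theorem joinedNext_iterate_modEq {k : ℕ} (hk : 2 ≤ k) (hT : IsPrimitiveF2 (trinomial k))
    (x : Fin k → ZMod 2) {a b : ℕ} (h : a ≡ b [MOD 2 ^ k]) :
    (joinedNext k)^[a] x = (joinedNext k)^[b] x := by
  have hp : Function.Periodic (fun t => (joinedNext k)^[t] x) (2 ^ k) := fun t => by
    simp only [Function.iterate_add_apply, joinedNext_iterate_period hk hT]
  rw [← hp.map_mod_nat a, ← hp.map_mod_nat b, h]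

/-- The joined register runs through all states in a single cycle. -/
theorem modEq_of_joinedNext_iterate_eq {k : ℕ} (hk : 2 ≤ k) (hT : IsPrimitiveF2 (trinomial k))
    (x : Fin k → ZMod 2) {a b : ℕ} (h : (joinedNext k)^[a] x = (joinedNext k)^[b] x) :
    a ≡ b [MOD 2 ^ k] := by
  set f : Fin (2 ^ k) → (Fin k → ZMod 2) := fun t => (joinedNext k)^[t] x
  have hpos : 0 < 2 ^ k := by positivity
  have hsurj : Function.Surjective f := by
    intro y
    obtain ⟨c, hc, rfl⟩ := exists_joinedNext_iterate_zero hk hT x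
    obtain ⟨d, hd, rfl⟩ := exists_joinedNext_iterate_zero hk hT y
    -- The time from state `c` to state `d`, with `2^k` added to keep the subtraction in `ℕ`.
    refine ⟨⟨(d + (2 ^ k - c)) % 2 ^ k, Nat.mod_lt _ hpos⟩, ?_⟩
    simp only [f, ← Function.iterate_add_apply]
    apply joinedNext_iterate_modEq hk hT
    have : (d + (2 ^ k - c)) % 2 ^ k + c ≡ (d + (2 ^ k - c)) + c [MOD 2 ^ k] :=
      (Nat.mod_modEq _ _).add_right _
    refine this.trans ?_
    rw [show d + (2 ^ k - c) + c = d + 2 ^ k by omega]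
    simp [Nat.ModEq]
  have hinj := ((Fintype.bijective_iff_surjective_and_card f).2 ⟨hsurj, by simp [ZMod.card]⟩).1
  have := @hinj ⟨a % 2 ^ k, Nat.mod_lt _ hpos⟩ ⟨b % 2 ^ k, Nat.mod_lt _ hpos⟩ (by
    simp only [f]
    rw [joinedNext_iterate_modEq hk hT x (Nat.mod_modEq a _),
      joinedNext_iterate_modEq hk hT x (Nat.mod_modEq b _), h])
  simpa [Nat.ModEq] using this

/-! ### Cyclic words and the de Bruijn property. -/

/-- The letters of a word, read cyclically. -/
def cyc (L : List (Fin 2)) (i : ℕ) : Fin 2 := L.getD (i % L.length) 0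

theorem cyc_mod (L : List (Fin 2)) (i : ℕ) : cyc L (i % L.length) = cyc L i := by simp [cyc]

theorem cyc_of_lt {L : List (Fin 2)} {i : ℕ} (h : i < L.length) : cyc L i = L[i] := by
  simp [cyc, Nat.mod_eq_of_lt h, h]

theorem cyc_rotate (L : List (Fin 2)) (n i : ℕ) : cyc (L.rotate n) i = cyc L (i + n) := by
  rcases Nat.eq_zero_or_pos L.length with h | h
  · rw [List.length_eq_zero_iff.1 h]; simp [cyc]
  · have h1 : i % L.length < (L.rotate n).length := by simpa using Nat.mod_lt i h
    rw [← cyc_mod, List.length_rotate, cyc_of_lt h1, List.getElem_rotate,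
      ← cyc_of_lt (Nat.mod_lt _ h), cyc_mod, ← cyc_mod, Nat.mod_add_mod, cyc_mod]

theorem replicate_zero_prefix_iff {k : ℕ} {U : List (Fin 2)} (h : k ≤ U.length) :
    List.replicate k 0 <+: U ↔ ∀ l < k, cyc U l = 0 := by
  constructor
  · intro hp l hl
    rw [cyc_of_lt (by omega), ← hp.getElem (by simpa using hl)]; simp
  · intro hz
    rw [List.prefix_iff_eq_take]
    refine List.ext_getElem (by simp [h]) fun i h1 h2 => ?_
    simp only [List.length_replicate] at h1
    rw [List.getElem_replicate, List.getElem_take, ← cyc_of_lt (by omega), hz i h1]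

/-- Cyclic binary words of length `2 ^ k` whose windows of length `k` are distinct, in which each
letter is determined by the `k` letters following it, by the rule of the reversed and complemented
joined register. -/
structure IsJoinedDeBruijn (k : ℕ) (L : List (Fin 2)) : Prop where
  length_eq : L.length = 2 ^ k
  modEq : ∀ i j, (∀ l < k, cyc L (i + l) = cyc L (j + l)) → i ≡ j [MOD 2 ^ k]
  eq_one_iff : ∀ i, cyc L i = 1 ↔
    Xor (cyc L (i + (k - 1)) = cyc L (i + k)) (∀ l, 1 ≤ l → l < k → cyc L (i + l) = 1)

theorem IsJoinedDeBruijn.rotate {k : ℕ} {L : List (Fin 2)} (h : IsJoinedDeBruijn k L) (n : ℕ) :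
    IsJoinedDeBruijn k (L.rotate n) where
  length_eq := by simpa using h.length_eq
  modEq i j hij := by
    simp only [cyc_rotate] at hij
    refine Nat.ModEq.add_right_cancel' n (h.modEq (i + n) (j + n) fun l hl => ?_)
    rw [add_right_comm, hij l hl, add_right_comm]
  eq_one_iff i := by
    simp only [cyc_rotate, h.eq_one_iff (i + n), add_right_comm i n]

theorem IsJoinedDeBruijn.exists_window {k : ℕ} {L : List (Fin 2)} (h : IsJoinedDeBruijn k L)
    (f : ℕ → Fin 2) : ∃ i < 2 ^ k, ∀ l < k, cyc L (i + l) = f l := by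
  let g : Fin (2 ^ k) → (Fin k → Fin 2) := fun i l => cyc L (i + l)
  have hinj : Function.Injective g := by
    intro i j hij
    have := h.modEq i j fun l hl => congrFun hij ⟨l, hl⟩
    exact Fin.ext (this.eq_of_lt_of_lt i.2 j.2)
  obtain ⟨i, hi⟩ := ((Fintype.bijective_iff_injective_and_card g).2 ⟨hinj, by simp⟩).2
    fun l => f l
  exact ⟨i, i.2, fun l hl => congrFun hi ⟨l, hl⟩⟩

theorem complement_complement (a : Fin 2) : complement (complement a) = a := by
  revert a; decide

theorem toLetter_injective : Function.Injective toLetter := by decide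

/-- Reversal exchanges position `i` with time `-1 - i` modulo `2^k`; the congruence avoids
subtraction. -/
theorem cyc_runMinimal {k : ℕ} (hk : 2 ≤ k) (hT : IsPrimitiveF2 (trinomial k))
    (seed : Fin k → ZMod 2) {i t : ℕ} (h : i + t + 1 ≡ 0 [MOD 2 ^ k]) :
    cyc ((joinedWord k seed).reverse.map complement) i =
      complement (toLetter ((joinedNext k)^[t] seed ⟨0, by omega⟩)) := by
  have hpos : 0 < 2 ^ k := by positivity
  set M := (joinedWord k seed).reverse.map complement with hM
  have hlen : M.length = 2 ^ k := by simp [hM, joinedWord]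
  have hlt : i % 2 ^ k < 2 ^ k := Nat.mod_lt _ hpos
  rw [← cyc_mod, hlen, cyc_of_lt (by omega)]
  simp only [hM, joinedWord, List.getElem_map, List.getElem_reverse, List.length_map,
    List.length_range, List.getElem_range, firstBit, dif_pos (show 0 < k by omega)]
  rw [joinedNext_iterate_modEq hk hT seed (b := t)]
  refine Nat.ModEq.add_right_cancel' (i % 2 ^ k + 1) ?_
  rw [show 2 ^ k - 1 - i % 2 ^ k + (i % 2 ^ k + 1) = 2 ^ k by omega]
  have h2 : t + (i % 2 ^ k + 1) ≡ t + (i + 1) [MOD 2 ^ k] :=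
    ((Nat.mod_modEq i _).add_right 1).add_left t
  rw [show t + (i + 1) = i + t + 1 by omega] at h2
  have h3 : 2 ^ k ≡ 0 [MOD 2 ^ k] := by simp [Nat.ModEq]
  exact h3.trans (h2.trans h).symm

theorem isJoinedDeBruijn_joinedWord {k : ℕ} (hk : 2 ≤ k) (hT : IsPrimitiveF2 (trinomial k))
    (seed : Fin k → ZMod 2) :
    IsJoinedDeBruijn k ((joinedWord k seed).reverse.map complement) := by
  have hpos : 0 < 2 ^ k := by positivity
  set M := (joinedWord k seed).reverse.map complement with hM
  -- the time at which the register starts to put out the mirror image of the window at `i`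
  have htime : ∀ i, ∃ t, i + k + t ≡ 0 [MOD 2 ^ k] := fun i =>
    ⟨(2 ^ k - 1) * (i + k), by
      have : i + k + (2 ^ k - 1) * (i + k) = 2 ^ k * (i + k) := by
        obtain ⟨n, hn⟩ : ∃ n, 2 ^ k = n + 1 := ⟨2 ^ k - 1, by omega⟩
        rw [hn, Nat.add_sub_cancel]; ring
      rw [this]; simp [Nat.ModEq]⟩
  have hshift : ∀ (t i : ℕ) (hi : i < k),
      (joinedNext k)^[t] seed ⟨i, hi⟩ = (joinedNext k)^[t + i] seed ⟨0, by omega⟩ :=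
    iterate_shift_apply (fun x i h => joinedNext_of_lt x h) seed
  -- A window is the complement of a state read from right to left.
  have hwin : ∀ i t, i + k + t ≡ 0 [MOD 2 ^ k] → ∀ l (hl : l < k), cyc M (i + l) =
      complement (toLetter ((joinedNext k)^[t] seed ⟨k - 1 - l, by omega⟩)) := by
    intro i t h l hl
    rw [hshift]
    apply cyc_runMinimal hk hT
    rwa [show i + l + (t + (k - 1 - l)) + 1 = i + k + t by omega]
  refine ⟨by simp [hM, joinedWord], ?_, ?_⟩
  · intro i j hij
    obtain ⟨t, ht⟩ := htime i
    obtain ⟨t', ht'⟩ := htime j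
    have hst : (joinedNext k)^[t] seed = (joinedNext k)^[t'] seed := by
      funext ⟨l, hl⟩
      have h := hij (k - 1 - l) (by omega)
      rw [hwin i t ht _ (by omega), hwin j t' ht' _ (by omega)] at h
      simp only [show k - 1 - (k - 1 - l) = l by omega] at h
      have h' := congrArg complement h
      rw [complement_complement, complement_complement] at h'
      exact toLetter_injective h'
    have htt := modEq_of_joinedNext_iterate_eq hk hT seed hst
    refine Nat.ModEq.add_right_cancel' k (Nat.ModEq.add_right_cancel' t ?_)
    exact ht.trans ((htt.add_left (j + k)).trans ht').symm
  · intro i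
    -- The state at time `t` mirrors the window following position `i`, so the letter at `i` mirrors
    -- the bit fed in at the next step.
    obtain ⟨t, ht⟩ := htime (i + 1)
    have h0 : cyc M i =
        complement (toLetter (joinedNext k ((joinedNext k)^[t] seed) ⟨k - 1, by omega⟩)) := by
      rw [← Function.iterate_succ_apply' (joinedNext k), hshift]
      apply cyc_runMinimal hk hT
      rwa [show i + (t.succ + (k - 1)) + 1 = i + 1 + k + t by omega]
    have hl : ∀ l, ∀ _ : 1 ≤ l, ∀ _ : l ≤ k, cyc M (i + l) =
        complement (toLetter ((joinedNext k)^[t] seed ⟨k - l, by omega⟩)) := by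
      intro l h1 h2
      have := hwin (i + 1) t ht (l - 1) (by omega)
      rw [show i + 1 + (l - 1) = i + l by omega] at this
      simpa only [show k - 1 - (l - 1) = k - l by omega] using this
    have hcond : (∀ l, 1 ≤ l → l < k → cyc M (i + l) = 1) ↔
        ∀ j : Fin k, (j : ℕ) ≠ 0 → (joinedNext k)^[t] seed j = 0 := by
      have hz : ∀ a : ZMod 2, complement (toLetter a) = 1 ↔ a = 0 := by decide
      constructor
      · intro h ⟨j, hj⟩ hj0
        have := h (k - j) (by omega) (by simp only [ne_eq] at hj0; omega)
        rw [hl _ (by omega) (by omega), hz] at this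
        simpa only [show k - (k - j) = j by omega] using this
      · intro h l h1 h2
        rw [hl l h1 h2.le, hz]
        exact h _ (by simp only [ne_eq]; omega)
    classical
    rw [h0, hl (k - 1) (by omega) (by omega), hl k (by omega) le_rfl, hcond, joinedNext_last hk]
    simp only [show k - (k - 1) = 1 by omega, Nat.sub_self]
    -- Complementing cancels in the comparison of `a` and `b`, while on the left it turns "the new
    -- bit is `1`" into "the new bit is `0`".
    have key : ∀ a b e : ZMod 2, e = 0 ∨ e = 1 → (complement (toLetter (a + b + e)) = 1 ↔
        Xor (complement (toLetter b) = complement (toLetter a)) (e = 1)) := by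
      unfold Xor; decide
    rw [key _ _ _ (by split_ifs <;> simp)]
    simp

theorem existsUnique_isZeroRotation {k : ℕ} (hk : 2 ≤ k) (hT : IsPrimitiveF2 (trinomial k))
    (seed : Fin k → ZMod 2) : ∃! U : List (Fin 2), IsZeroRotation k seed U := by
  have hM := isJoinedDeBruijn_joinedWord hk hT seed
  set M := (joinedWord k seed).reverse.map complement with hMdef
  have hkN : k < 2 ^ k := Nat.lt_two_pow_self
  have hlen : ∀ n, (M.rotate n).length = 2 ^ k := fun n => (hM.rotate n).length_eq
  obtain ⟨a, ha, hz⟩ := hM.exists_window fun _ => 0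
  refine ⟨M.rotate a, ⟨?_, ?_⟩, ?_⟩
  · exact Cycle.coe_eq_coe.2 (List.IsRotated.forall M a)
  · rw [replicate_zero_prefix_iff (by rw [hlen]; omega)]
    intro l hl
    rw [cyc_rotate, add_comm, hz l hl]
  · rintro U ⟨hU, hp⟩
    obtain ⟨n, rfl⟩ := (Cycle.coe_eq_coe.1 hU).symm
    rw [replicate_zero_prefix_iff (by rw [hlen]; omega)] at hp
    have := hM.modEq n a fun l hl => by rw [hz l hl, add_comm, ← cyc_rotate, hp l hl]
    rw [← List.rotate_mod, ← List.rotate_mod M a, hM.length_eq, this]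

theorem IsZeroRotation.isJoinedDeBruijn {k : ℕ} (hk : 2 ≤ k) (hT : IsPrimitiveF2 (trinomial k))
    {seed : Fin k → ZMod 2} {U : List (Fin 2)} (h : IsZeroRotation k seed U) :
    IsJoinedDeBruijn k U ∧ ∀ l < k, cyc U l = 0 := by
  obtain ⟨hU, hp⟩ := h
  obtain ⟨n, rfl⟩ := (Cycle.coe_eq_coe.1 hU).symm
  have hM := (isJoinedDeBruijn_joinedWord hk hT seed).rotate n
  refine ⟨hM, (replicate_zero_prefix_iff ?_).1 hp⟩
  rw [hM.length_eq]
  exact Nat.lt_two_pow_self.le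

/-! ### The terminated linearization and the value of `χ`. -/

theorem terminate_eq {α : Type*} (w : List α) : terminate w = w.map WithBot.some ++ [⊥] := by
  rw [terminate]
  induction w with
  | nil => rfl
  | cons a l ih => rw [List.map_cons, List.cons_append, ← ih]; rfl

/-- The letters of the terminated linearization. -/
theorem getElem_terminate_linearize {k : ℕ} {U : List (Fin 2)} (hk : k ≤ U.length) (hk1 : 1 ≤ k) :
    (terminate (linearize k U)).length = U.length + k ∧
    (∀ i, (h : i < (terminate (linearize k U)).length) → i < U.length + (k - 1) →
      (terminate (linearize k U))[i] = (cyc U i : WithBot (Fin 2))) ∧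
    ∀ h : U.length + (k - 1) < (terminate (linearize k U)).length,
      (terminate (linearize k U))[U.length + (k - 1)] = ⊥ := by
  have hl : (linearize k U).length = U.length + (k - 1) := by
    simp only [linearize, List.length_append, List.length_take]; omega
  refine ⟨by simp only [terminate_eq, List.length_append, List.length_map, hl,
    List.length_singleton]; omega, ?_, ?_⟩
  · intro i h hi
    simp only [terminate_eq]
    rw [List.getElem_append_left (by simpa [hl] using hi), List.getElem_map]
    refine congrArg _ ?_
    simp only [linearize]
    by_cases hU : i < U.length
    · rw [List.getElem_append_left hU, cyc_of_lt hU]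
    · rw [List.getElem_append_right (by omega), List.getElem_take, ← cyc_of_lt (by omega),
        ← cyc_mod U i, Nat.mod_eq_sub_mod (by omega), cyc_mod]
  · intro h
    simp only [terminate_eq]
    rw [List.getElem_append_right (by simp [hl])]
    simp

theorem append_singleton_infix_iff {α : Type*} {x v : List α} {a : α} :
    (x ++ [a]) <:+: v ↔ ∃ p, ∃ h : p + x.length < v.length,
      (∀ l, (hl : l < x.length) → v[p + l] = x[l]) ∧ v[p + x.length] = a := by
  rw [List.infix_iff_getElem?]
  constructor
  · rintro ⟨p, hp, hx⟩
    simp only [List.length_append, List.length_singleton] at hp hx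
    refine ⟨p, by omega, fun l hl => ?_, ?_⟩
    · have := hx l (by omega)
      rw [List.getElem?_eq_getElem (by omega), Option.some_inj,
        List.getElem_append_left hl] at this
      simpa only [add_comm] using this
    · have := hx x.length (by omega)
      rw [List.getElem?_eq_getElem (by omega), Option.some_inj] at this
      simpa [add_comm] using this
  · rintro ⟨p, hp, hx, ha⟩
    refine ⟨p, by simp only [List.length_append, List.length_singleton]; omega, fun l hl => ?_⟩
    simp only [List.length_append, List.length_singleton] at hl
    rw [List.getElem?_eq_getElem (by omega), Option.some_inj]
    rcases Nat.lt_succ_iff_lt_or_eq.1 hl with h | rfl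
    · rw [List.getElem_append_left h, ← hx l h]
      simp only [add_comm]
    · simpa [add_comm] using ha

theorem append_singleton_suffix_take {α : Type*} {x v : List α} {a : α} {p : ℕ}
    (h : p + x.length < v.length) (hx : ∀ l, (hl : l < x.length) → v[p + l] = x[l])
    (ha : v[p + x.length] = a) : x ++ [a] <:+ v.take (p + x.length + 1) := by
  refine ⟨v.take p, List.ext_getElem ?_ fun i h1 h2 => ?_⟩
  · simp only [List.length_append, List.length_take, List.length_singleton]; omega
  · simp only [List.length_take] at h2
    rw [List.getElem_take]
    by_cases hi : i < p
    · rw [List.getElem_append_left (by simp only [List.length_take]; omega), List.getElem_take]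
    · rw [List.getElem_append_right (by simp only [List.length_take]; omega)]
      simp only [List.length_take, Nat.min_eq_left (show p ≤ v.length by omega)]
      by_cases hi' : i - p < x.length
      · rw [List.getElem_append_left hi', ← hx _ hi']
        simp only [show p + (i - p) = i by omega]
      · have : i = p + x.length := by omega
        subst this
        simp [ha]

theorem chi_linearize {k : ℕ} (hk : 2 ≤ k) {U : List (Fin 2)} (hU : IsJoinedDeBruijn k U)
    (hz : ∀ l < k, cyc U l = 0) : chi (linearize k U) = 2 ^ k + 1 := by
  have hkN : k < 2 ^ k := Nat.lt_two_pow_self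
  obtain ⟨hlen, hget, hbot⟩ :=
    getElem_terminate_linearize (k := k) (U := U) (by rw [hU.length_eq]; omega) (by omega)
  rw [chi, suffixientSize]
  set v := terminate (linearize k U) with hv
  rw [hU.length_eq] at hlen hget
  have hbot' : ∀ (i : ℕ) (h : i < v.length), i = 2 ^ k + (k - 1) → v[i] = ⊥ := by
    intro i h hi
    rw [← hU.length_eq] at hi
    subst hi
    exact hbot h
  have hwin : ∀ p q, p < 2 ^ k → q < 2 ^ k → (∀ l < k, cyc U (p + l) = cyc U (q + l)) → p = q :=
    fun p q hp hq h => (hU.modEq p q h).eq_of_lt_of_lt hp hq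
  apply le_antisymm
  -- These are the end positions of all `2^k + 1` windows of length `k`, the last being that of the
  -- end-marker.
  · refine Nat.sInf_le ⟨(Finset.range (2 ^ k + 1)).image (· + (k - 1)), ⟨?_, ?_⟩, ?_⟩
    · intro j hj
      simp only [Finset.mem_image, Finset.mem_range] at hj
      obtain ⟨i, hi, rfl⟩ := hj
      omega
    · rintro y ⟨x, a, b, rfl, hba, hxa, hxb⟩
      obtain ⟨p, hp, hpx, hpa⟩ := append_singleton_infix_iff.1 hxa
      obtain ⟨q, hq, hqx, hqb⟩ := append_singleton_infix_iff.1 hxb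
      -- Both occurrences of `x` avoid the end-marker, so a common window of length `k` would make
      -- them the same occurrence, with the same next letter.
      have hxk : x.length < k := by
        by_contra hxk
        have : p = q := by
          refine hwin p q (by omega) (by omega) fun l hl => ?_
          have h1 := hpx l (by omega)
          have h2 := hqx l (by omega)
          rw [← h2, hget _ _ (by omega), hget _ _ (by omega)] at h1
          exact WithBot.coe_injective h1
        subst this
        exact hba (hqb.symm.trans hpa)
      by_cases hc : k ≤ p + x.length + 1
      · refine ⟨p + x.length, ?_, append_singleton_suffix_take hp hpx hpa⟩
        simp only [Finset.mem_image, Finset.mem_range]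
        exact ⟨p + x.length - (k - 1), by omega, by omega⟩
      -- An occurrence ending before position `k - 1` lies inside the initial `0^k`; it is a block
      -- of zeros and can be slid to end at `k - 1`.
      · refine ⟨k - 1, ?_, ?_⟩
        · simp only [Finset.mem_image, Finset.mem_range]
          exact ⟨0, by omega, by omega⟩
        · have hv0 : ∀ i (hi : i < v.length), i < k → v[i] = ((0 : Fin 2) : WithBot (Fin 2)) := by
            intro i hi hik
            rw [hget i hi (by omega), hz i hik]
          have := append_singleton_suffix_take (p := k - 1 - x.length) (x := x) (v := v) (a := a)
            (by omega) (fun l hl => by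
              rw [← hpx l hl, hv0 _ _ (by omega), hv0 _ _ (by omega)])
            (by rw [← hpa, hv0 _ _ (by omega), hv0 _ _ (by omega)])
          rwa [show k - 1 - x.length + x.length = k - 1 by omega] at this
    · rw [Finset.card_image_of_injective _ (add_left_injective _), Finset.card_range]
  · refine le_csInf ((exists_isSuffixient v).elim fun S hS => ⟨S.card, S, hS, rfl⟩) ?_
    rintro n ⟨S, ⟨-, hS⟩, rfl⟩
    -- the windows of length `k` are right-extensions, no two of which share a position
    have hext : ∀ i ≤ 2 ^ k, (v.drop i).take k ∈ rightExtensions v := by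
      intro i hi
      have hx : (v.drop i).take k = (v.drop i).take (k - 1) ++ [v[i + (k - 1)]'(by omega)] := by
        obtain ⟨m, rfl⟩ : ∃ m, k = m + 1 := ⟨k - 1, by omega⟩
        rw [List.take_succ_eq_append_getElem (by simp only [List.length_drop]; omega)]
        simp
      have hxl : ((v.drop i).take (k - 1)).length = k - 1 := by
        simp only [List.length_take, List.length_drop]; omega
      obtain ⟨c, hc⟩ : ∃ c : Fin 2, (c : WithBot (Fin 2)) ≠ v[i + (k - 1)]'(by omega) := by
        rcases hi.lt_or_eq with hi' | hi'
        · obtain ⟨c, hc⟩ := exists_ne (cyc U (i + (k - 1)))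
          refine ⟨c, ?_⟩
          rw [hget _ _ (by omega)]
          exact fun h => hc (WithBot.coe_injective h)
        · refine ⟨0, ?_⟩
          rw [hbot' _ _ (by omega)]
          exact WithBot.coe_ne_bot
      -- All binary words of length `k` occur, in particular this window with its last letter
      -- replaced by `c`.
      obtain ⟨i', hi', hw⟩ := hU.exists_window fun l => if l < k - 1 then cyc U (i + l) else c
      have hwi : ∀ l < k - 1, cyc U (i' + l) = cyc U (i + l) := fun l hl => by
        rw [hw l (by omega), if_pos hl]
      have hci : cyc U (i' + (k - 1)) = c := by rw [hw _ (by omega), if_neg (lt_irrefl _)]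
      refine ⟨_, _, (c : WithBot (Fin 2)), hx, hc, ?_, ?_⟩
      · rw [append_singleton_infix_iff]
        refine ⟨i, by omega, fun l hl => by simp, by simp only [hxl]⟩
      · rw [append_singleton_infix_iff]
        refine ⟨i', by omega, fun l hl => ?_, ?_⟩
        · rw [List.getElem_take, List.getElem_drop, hget _ _ (by omega), hget _ _ (by omega),
            hwi l (by omega)]
        · simp only [hxl]
          rw [hget _ _ (by omega), hci]
    choose! j hj hsuf using fun i hi => hS _ (hext i hi)
    have : (Finset.range (2 ^ k + 1)).card ≤ S.card := by
      refine Finset.card_le_card_of_injOn j (fun i hi => hj i ?_) fun p hp q hq hpq => ?_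
      · simp only [Finset.coe_range, Set.mem_Iio] at hi; omega
      · simp only [Finset.coe_range, Set.mem_Iio] at hp hq
        have h1 := hsuf p (by omega)
        have h2 := hsuf q (by omega)
        rw [← hpq] at h2
        have hwl : ∀ i ≤ 2 ^ k, ((v.drop i).take k).length = k := fun i hi => by
          simp only [List.length_take, List.length_drop]; omega
        have he : (v.drop p).take k = (v.drop q).take k :=
          (List.suffix_of_suffix_length_le h1 h2
            (by rw [hwl p (by omega), hwl q (by omega)])).eq_of_length
            (by rw [hwl p (by omega), hwl q (by omega)])
        have hl : ∀ l, (hl : l < k) → v[p + l] = v[q + l] := fun l hl => by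
          have h1 := List.getElem_of_eq he (i := l) (by rw [hwl p (by omega)]; exact hl)
          simpa only [List.getElem_take, List.getElem_drop] using h1
        have hlast := hl (k - 1) (by omega)
        -- Only the window starting at `2^k` ends in the end-marker, so the mixed cases are
        -- impossible.
        rcases Nat.lt_or_ge p (2 ^ k) with hp' | hp' <;> rcases Nat.lt_or_ge q (2 ^ k) with hq' | hq'
        · refine hwin p q hp' hq' fun l hlk => ?_
          have := hl l hlk
          rw [hget _ _ (by omega), hget _ _ (by omega)] at this
          exact WithBot.coe_injective this
        · rw [hget _ _ (by omega), hbot' _ _ (by omega)] at hlast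
          exact absurd hlast WithBot.coe_ne_bot
        · rw [hbot' _ _ (by omega), hget _ _ (by omega)] at hlast
          exact absurd hlast.symm WithBot.coe_ne_bot
        · omega
    simpa using this

/-! ### Runs, binary values and preceding letters. -/

theorem length_splitBy_loop {α : Type*} (R : α → α → Bool) (l : List α) (a : α) (g : List α)
    (gs : List (List α)) :
    (List.splitBy.loop R l a g gs).length = gs.length + (List.splitBy.loop R l a [] []).length := by
  induction l generalizing a g gs with
  | nil => simp [List.splitBy.loop]
  | cons b l ih =>
    simp only [List.splitBy.loop]
    cases R a b
    · rw [ih, ih b [] [_]]; simp [add_assoc]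
    · rw [ih, ih b [a] []]; simp

theorem numRuns_cons_cons {α : Type*} [DecidableEq α] (a b : α) (l : List α) :
    numRuns (a :: b :: l) = numRuns (b :: l) + if a = b then 0 else 1 := by
  simp only [numRuns, List.splitBy, List.splitBy.loop]
  by_cases h : a = b
  · simp only [h, decide_true]; rw [length_splitBy_loop]; simp
  · simp only [h, decide_false]; rw [length_splitBy_loop]; simp [add_comm]

theorem numRuns_singleton {α : Type*} [DecidableEq α] (a : α) : numRuns [a] = 1 := by
  simp [numRuns, List.splitBy, List.splitBy.loop]

theorem numRuns_replicate_append {α : Type*} [DecidableEq α] {a b : α} (h : a ≠ b) (n : ℕ)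
    (l : List α) : numRuns (List.replicate (n + 1) a ++ b :: l) = numRuns (b :: l) + 1 := by
  induction n with
  | zero => simp [numRuns_cons_cons, h]
  | succ n ih =>
    rw [List.replicate_succ, List.cons_append, List.replicate_succ, List.cons_append,
      numRuns_cons_cons, if_pos rfl, ← List.cons_append, ← List.replicate_succ, ih]

/-- The value of the first `n` letters of `f`, as a binary number with the most significant
letter first. -/
def binaryValue (f : ℕ → Fin 2) : ℕ → ℕ
  | 0 => 0
  | n + 1 => 2 * binaryValue f n + f n

theorem binaryValue_lt (f : ℕ → Fin 2) (n : ℕ) : binaryValue f n < 2 ^ n := by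
  induction n with
  | zero => simp [binaryValue]
  | succ n ih =>
    have := (f n).2
    simp only [binaryValue, pow_succ]; omega

theorem eq_of_binaryValue_eq {f g : ℕ → Fin 2} {n : ℕ} (h : binaryValue f n = binaryValue g n) :
    ∀ l < n, f l = g l := by
  induction n with
  | zero => intro l hl; omega
  | succ n ih =>
    have h1 := (f n).2
    have h2 := (g n).2
    simp only [binaryValue] at h
    intro l hl
    rcases Nat.lt_succ_iff_lt_or_eq.1 hl with hl | rfl
    · exact ih (by omega) l hl
    · exact Fin.ext (by omega)

theorem binaryValue_congr {f g : ℕ → Fin 2} {n : ℕ} (h : ∀ l < n, f l = g l) :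
    binaryValue f n = binaryValue g n := by
  induction n with
  | zero => rfl
  | succ n ih => rw [binaryValue, binaryValue, ih fun l hl => h l (by omega), h n (by omega)]

theorem binaryValue_zero (n : ℕ) : binaryValue (fun _ => 0) n = 0 := by
  induction n with
  | zero => rfl
  | succ n ih => simp [binaryValue, ih]

theorem binaryValue_one (n : ℕ) : binaryValue (fun _ => 1) n + 1 = 2 ^ n := by
  induction n with
  | zero => rfl
  | succ n ih => simp only [binaryValue, pow_succ, Fin.val_one]; omega

/-- Numerical order of equal-length binary words is lexicographic order: a larger prefix value
cannot be compensated by one further digit. -/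
theorem exists_lt_of_binaryValue_lt {f g : ℕ → Fin 2} {n : ℕ}
    (h : binaryValue f n < binaryValue g n) : ∃ i < n, (∀ j < i, f j = g j) ∧ f i < g i := by
  induction n with
  | zero => simp [binaryValue] at h
  | succ n ih =>
    have h1 := (f n).2
    have h2 := (g n).2
    simp only [binaryValue] at h
    rcases lt_trichotomy (binaryValue f n) (binaryValue g n) with hlt | heq | hgt
    · obtain ⟨i, hi, h'⟩ := ih hlt
      exact ⟨i, by omega, h'⟩
    · exact ⟨n, by omega, eq_of_binaryValue_eq heq, Fin.lt_def.2 (by omega)⟩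
    · omega

/-- The letter preceding a window of value `b` in the reversed and complemented cyclic word of
length `N`. -/
def precedingLetter (N b : ℕ) : Fin 2 :=
  if Xor (b % 4 = 0 ∨ b % 4 = 3) (N - 2 ≤ b) then 1 else 0

/-- The residue modulo `4` records the last two letters of the window, and a value of at least `2^k
- 2` means that its first `k - 1` letters are all `1`. -/
theorem IsJoinedDeBruijn.cyc_eq_precedingLetter {k : ℕ} (hk : 2 ≤ k) {U : List (Fin 2)}
    (hU : IsJoinedDeBruijn k U) (i : ℕ) :
    cyc U i = precedingLetter (2 ^ k) (binaryValue (fun l => cyc U (i + 1 + l)) k) := by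
  obtain ⟨m, rfl⟩ : ∃ m, k = m + 2 := ⟨k - 2, by omega⟩
  set f := fun l => cyc U (i + 1 + l) with hf
  have h2 : ∀ a : Fin 2, a = if a = 1 then 1 else 0 := by decide
  rw [h2 (cyc U i), precedingLetter]
  congr 1
  have hc1 : (cyc U (i + (m + 2 - 1)) = cyc U (i + (m + 2))) ↔
      (binaryValue f (m + 2) % 4 = 0 ∨ binaryValue f (m + 2) % 4 = 3) := by
    have e1 : cyc U (i + (m + 2 - 1)) = f m := by simp only [hf]; congr 1; omega
    have e2 : cyc U (i + (m + 2)) = f (m + 1) := by simp only [hf]; congr 1; omega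
    rw [e1, e2, Fin.ext_iff]
    have h1 : (f m : ℕ) = 0 ∨ (f m : ℕ) = 1 := by omega
    have h2 : (f (m + 1) : ℕ) = 0 ∨ (f (m + 1) : ℕ) = 1 := by omega
    have hv : binaryValue f (m + 2) = 4 * binaryValue f m + 2 * f m + f (m + 1) := by
      simp only [binaryValue]; ring
    rw [hv]
    rcases h1 with h1 | h1 <;> rcases h2 with h2 | h2 <;> rw [h1, h2] <;> omega
  have hc2 : (∀ l, 1 ≤ l → l < m + 2 → cyc U (i + l) = 1) ↔
      2 ^ (m + 2) - 2 ≤ binaryValue f (m + 2) := by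
    have hone := binaryValue_one (m + 1)
    have hp : 2 ^ (m + 2) = 2 * 2 ^ (m + 1) := by ring
    have hv : binaryValue f (m + 2) = 2 * binaryValue f (m + 1) + f (m + 1) := rfl
    have hl := binaryValue_lt f (m + 1)
    have hb := (f (m + 1)).2
    constructor
    · intro h
      have : binaryValue f (m + 1) = binaryValue (fun _ => 1) (m + 1) :=
        binaryValue_congr fun l hl => by
          simp only [hf]; rw [add_assoc]; exact h _ (by omega) (by omega)
      omega
    · intro h l h1 h2
      have : binaryValue f (m + 1) = binaryValue (fun _ => 1) (m + 1) := by omega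
      have := eq_of_binaryValue_eq this (l - 1) (by omega)
      simp only [hf] at this
      rwa [show i + 1 + (l - 1) = i + l by omega] at this
  rw [hU.eq_one_iff i, hc1, hc2]

/-- The induction extends the range downwards from `N - 1`. The top three values give `0,1,0`
because of the flip at the last two; below them, the pattern `1,0,0,1` changes letter at every
second step. -/
theorem numRuns_map_precedingLetter {N : ℕ} (hN : 4 ∣ N) {n : ℕ} (h3 : 3 ≤ n) (hn : n < N) :
    numRuns ((List.range' (N - n) n).map
      fun b => (precedingLetter N b : WithBot (Fin 2))) = n / 2 + 2 := by
  have hinj : ∀ a b : Fin 2, ((a : WithBot (Fin 2)) = b) ↔ a = b :=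
    fun a b => WithBot.coe_inj
  induction n, h3 using Nat.le_induction with
  | base =>
    have e1 : precedingLetter N (N - 3) = 0 := by
      rw [precedingLetter, if_neg]; unfold Xor; omega
    have e2 : precedingLetter N (N - 3 + 1) = 1 := by
      rw [precedingLetter, if_pos]; unfold Xor; omega
    have e3 : precedingLetter N (N - 3 + 1 + 1) = 0 := by
      rw [precedingLetter, if_neg]; unfold Xor; omega
    simp only [List.range'_succ, List.range'_zero, List.map_cons, List.map_nil, e1, e2, e3,
      numRuns_cons_cons, numRuns_singleton, hinj]
    rfl
  | succ n h3 ih =>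
    obtain ⟨m, rfl⟩ : ∃ m, n = m + 1 := ⟨n - 1, by omega⟩
    have ih := ih (by omega)
    rw [List.range'_succ, List.map_cons, show N - (m + 1 + 1) + 1 = N - (m + 1) by omega]
    rw [List.range'_succ, List.map_cons] at ih ⊢
    rw [numRuns_cons_cons, ih]
    have : precedingLetter N (N - (m + 1 + 1)) = precedingLetter N (N - (m + 1)) ↔
        m % 2 = 1 := by
      have hx : ∀ (p q : Prop) [Decidable p] [Decidable q],
          ((if p then (1 : Fin 2) else 0) = if q then 1 else 0) ↔ (p ↔ q) := by
        intro p q _ _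
        by_cases hp : p <;> by_cases hq : q <;> simp [hp, hq]
      rw [precedingLetter, precedingLetter, hx]
      unfold Xor
      omega
    by_cases hm : m % 2 = 1
    · rw [if_pos ((hinj _ _).2 (this.2 hm))]; omega
    · rw [if_neg (mt (hinj _ _).1 (mt this.1 hm))]; omega

/-! ### The Burrows–Wheeler matrix and the value of `r`. -/

/-- Asking only for `≤` before `i` lets a row `0^j$…` be compared with a window row without locating
their first difference. -/
theorem lt_of_getElem_le_of_getElem_lt {α : Type*} [LinearOrder α] {x y : List α} {i : ℕ}
    (hx : i < x.length) (hy : i < y.length)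
    (hle : ∀ j, (hj : j < i) → x[j] ≤ y[j]) (hlt : x[i] < y[i]) : x < y := by
  have hex : ∃ j, ∃ hj : j ≤ i, x[j] ≠ y[j] := ⟨i, le_rfl, hlt.ne⟩
  classical
  obtain ⟨hj, hne⟩ := Nat.find_spec hex
  refine List.lt_iff_exists.2 (Or.inr ⟨Nat.find hex, by omega, by omega, fun j hj' => ?_, ?_⟩)
  · by_contra h
    exact Nat.find_min hex hj' ⟨by omega, h⟩
  · rcases hj.lt_or_eq with h | h
    · exact lt_of_le_of_ne (hle _ h) hne
    · simpa only [h] using hlt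

/-- The Burrows-Wheeler matrix, from an enumeration of the rotations in increasing order. -/
theorem bwMatrix_eq_of_pairwise {α : Type*} [LinearOrder α] {v : List α} {idx : List ℕ}
    (hlen : idx.length = v.length) (hlt : ∀ i ∈ idx, i < v.length)
    (hidx : idx.Pairwise fun i j => v.rotate i < v.rotate j) :
    bwMatrix v = idx.map fun i => v.rotate i := by
  have hnodup : idx.Nodup := hidx.imp fun {i j} h e => by subst e; exact lt_irrefl _ h
  have hperm : idx.Perm (List.range v.length) :=
    (List.subperm_of_subset hnodup fun i hi => List.mem_range.2 (hlt i hi)).perm_of_length_le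
      (by simp [hlen])
  refine List.Perm.eq_of_pairwise' (r := (· ≤ ·)) ?_ ?_ ?_
  · exact List.pairwise_mergeSort' (r := (· ≤ ·)) _
  · rw [List.pairwise_map]
    exact hidx.imp fun h => h.le
  · exact (List.mergeSort_perm _ _).trans (hperm.symm.map _)

theorem bwtRuns_linearize {k : ℕ} (hk : 2 ≤ k) {U : List (Fin 2)} (hU : IsJoinedDeBruijn k U)
    (hz : ∀ l < k, cyc U l = 0) : bwtRuns (linearize k U) = 2 ^ (k - 1) + 4 := by
  have hkN : k < 2 ^ k := Nat.lt_two_pow_self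
  obtain ⟨hlen, hget, hbot⟩ :=
    getElem_terminate_linearize (k := k) (U := U) (by rw [hU.length_eq]; omega) (by omega)
  rw [bwtRuns, bwt]
  set v := terminate (linearize k U) with hv
  rw [hU.length_eq] at hlen hget
  have hbot' : ∀ (i : ℕ) (h : i < v.length), i = 2 ^ k + (k - 1) → v[i] = ⊥ := by
    intro i h hi
    rw [← hU.length_eq] at hi
    subst hi
    exact hbot h
  have hz' : ∀ i, 2 ^ k ≤ i → i < 2 ^ k + k → cyc U i = 0 := by
    intro i h1 h2
    rw [← cyc_mod, hU.length_eq, Nat.mod_eq_sub_mod h1, Nat.mod_eq_of_lt (by omega)]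
    exact hz _ (by omega)
  -- the position of the window of a given value
  have hpos : ∀ b < 2 ^ k, ∃ i < 2 ^ k, binaryValue (fun l => cyc U (i + l)) k = b := by
    let g : Fin (2 ^ k) → Fin (2 ^ k) := fun i =>
      ⟨binaryValue (fun l => cyc U (i + l)) k, binaryValue_lt _ _⟩
    have hg : Function.Injective g := by
      intro i j hij
      have := hU.modEq i j (eq_of_binaryValue_eq (Fin.ext_iff.1 hij))
      exact Fin.ext (this.eq_of_lt_of_lt i.2 j.2)
    intro b hb
    obtain ⟨i, hi⟩ := (Finite.injective_iff_surjective.1 hg) ⟨b, hb⟩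
    exact ⟨i, i.2, Fin.ext_iff.1 hi⟩
  choose! pos hposlt hposval using hpos
  have hpos0 : pos 0 = 0 := by
    have h0 : 0 < 2 ^ k := by positivity
    refine (hU.modEq (pos 0) 0 (eq_of_binaryValue_eq ?_)).eq_of_lt_of_lt (hposlt 0 h0) h0
    refine ((hposval 0 h0).trans (binaryValue_zero k).symm).trans ?_
    exact binaryValue_congr fun l hl => by rw [zero_add, hz l hl]
  have hposne : ∀ b < 2 ^ k, b ≠ 0 → pos b ≠ 0 := by
    intro b hb hb0 h
    have := hposval b hb
    rw [h, ← hpos0, hposval 0 (by positivity)] at this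
    exact hb0 this.symm
  have hrot : ∀ i l, (h : i + l < v.length) → (h' : l < (v.rotate i).length) →
      (v.rotate i)[l] = v[i + l] := by
    intro i l h h'
    simp only [List.getElem_rotate, add_comm l i, Nat.mod_eq_of_lt h]
  have hrl : ∀ i, (v.rotate i).length = 2 ^ k + k := fun i => by rw [List.length_rotate, hlen]
  -- The start `2^k + (k - 1) - j` is that of the suffix `0^j$`. Such rows precede every row with at
  -- least `j + 1` letters before its end-marker, because the end-marker at index `j` is the
  -- smallest symbol.
  have hmat : bwMatrix v =
      ((List.range k).map (fun j => 2 ^ k + (k - 1) - j) ++ (List.range (2 ^ k)).map pos).map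
        fun i => v.rotate i := by
    refine bwMatrix_eq_of_pairwise (by simp [hlen, add_comm]) ?_ ?_
    · intro i hi
      simp only [List.mem_append, List.mem_map, List.mem_range] at hi
      rcases hi with ⟨j, hj, rfl⟩ | ⟨b, hb, rfl⟩
      · omega
      · have := hposlt b hb; omega
    · rw [List.pairwise_append]
      refine ⟨?_, ?_, ?_⟩
      · rw [List.pairwise_map]
        refine List.pairwise_lt_range.imp_of_mem fun {j j'} hj hj' hjj => ?_
        rw [List.mem_range] at hj hj'
        refine lt_of_getElem_le_of_getElem_lt (i := j) (by rw [hrl]; omega) (by rw [hrl]; omega)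
          (fun l hl => ?_) ?_
        · rw [hrot _ _ (by omega), hrot _ _ (by omega), hget _ _ (by omega), hget _ _ (by omega),
            hz' _ (by omega) (by omega), hz' _ (by omega) (by omega)]
        · rw [hrot _ _ (by omega), hrot _ _ (by omega), hbot' _ _ (by omega),
            hget _ _ (by omega)]
          exact WithBot.bot_lt_coe _
      · rw [List.pairwise_map]
        refine List.pairwise_lt_range.imp_of_mem fun {b b'} hb hb' hbb => ?_
        rw [List.mem_range] at hb hb'
        have h1 := hposlt b hb
        have h2 := hposlt b' hb'
        rw [← hposval b hb, ← hposval b' hb'] at hbb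
        obtain ⟨i, hi, heq, hlt⟩ := exists_lt_of_binaryValue_lt hbb
        refine lt_of_getElem_le_of_getElem_lt (i := i) (by rw [hrl]; omega) (by rw [hrl]; omega)
          (fun l hl => ?_) ?_
        · rw [hrot _ _ (by omega), hrot _ _ (by omega), hget _ _ (by omega), hget _ _ (by omega),
            heq l hl]
        · rw [hrot _ _ (by omega), hrot _ _ (by omega), hget _ _ (by omega), hget _ _ (by omega)]
          exact WithBot.coe_lt_coe.2 hlt
      · intro i hi i' hi'
        simp only [List.mem_map, List.mem_range] at hi hi'
        obtain ⟨j, hj, rfl⟩ := hi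
        obtain ⟨b, hb, rfl⟩ := hi'
        have h1 := hposlt b hb
        refine lt_of_getElem_le_of_getElem_lt (i := j) (by rw [hrl]; omega) (by rw [hrl]; omega)
          (fun l hl => ?_) ?_
        · rw [hrot _ _ (by omega), hrot _ _ (by omega), hget _ _ (by omega), hget _ _ (by omega),
            hz' _ (by omega) (by omega)]
          exact WithBot.coe_le_coe.2 (Fin.zero_le _)
        · rw [hrot _ _ (by omega), hrot _ _ (by omega), hbot' _ _ (by omega),
            hget _ _ (by omega)]
          exact WithBot.bot_lt_coe _
  have hlast0 : (v.rotate 0).getLastD ⊥ = ⊥ := by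
    rw [List.rotate_zero, List.getLastD_eq_getLast?, List.getLast?_eq_getElem?,
      List.getElem?_eq_getElem (by omega), hbot' _ _ (by omega)]
    rfl
  have hlast : ∀ i, 0 < i → i < 2 ^ k + k → (v.rotate i).getLastD ⊥ =
      (cyc U (i - 1) : WithBot (Fin 2)) := by
    intro i h0 hi
    rw [List.getLastD_eq_getLast?, List.getLast?_eq_getElem?,
      List.getElem?_eq_getElem (by rw [hrl]; omega), List.getElem_rotate]
    simp only [hrl, hlen, show 2 ^ k + k - 1 + i = i - 1 + (2 ^ k + k) by omega,
      Nat.add_mod_right, Nat.mod_eq_of_lt (show i - 1 < 2 ^ k + k by omega)]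
    rw [hget _ _ (by omega)]
    rfl
  have h4 : 4 ∣ 2 ^ k := pow_dvd_pow 2 hk
  have hbwt : (bwMatrix v).map (fun row => row.getLastD ⊥) =
      List.replicate (k - 1) ((0 : Fin 2) : WithBot (Fin 2)) ++ ((1 : Fin 2) : WithBot (Fin 2)) ::
        ⊥ :: (List.range' 1 (2 ^ k - 1)).map
          fun b => (precedingLetter (2 ^ k) b : WithBot (Fin 2)) := by
    rw [hmat, List.map_map, List.map_append, List.map_map, List.map_map]
    have e1 : List.range k = List.range (k - 1) ++ [k - 1] := by
      rw [← List.range_succ]; congr 1; omega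
    have e2 : List.range (2 ^ k) = 0 :: List.range' 1 (2 ^ k - 1) := by
      rw [List.range_eq_range', show 2 ^ k = (2 ^ k - 1) + 1 by omega, List.range'_succ]; simp
    rw [e1, e2, List.map_append, List.map_singleton, List.map_cons, List.append_assoc,
      List.singleton_append]
    congr 1
    · refine List.eq_replicate_iff.2 ⟨by simp, ?_⟩
      intro y hy
      simp only [List.mem_map, List.mem_range, Function.comp] at hy
      obtain ⟨j, hj, rfl⟩ := hy
      rw [hlast _ (by omega) (by omega), hz' _ (by omega) (by omega)]
    · congr 1
      · simp only [Function.comp]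
        -- The row `0^(k-1)$…` starts at `2^k`; the letter before it cyclically precedes the window
        -- `0^k`, of value `0`.
        rw [hlast _ (by omega) (by omega), show 2 ^ k + (k - 1) - (k - 1) - 1 = 2 ^ k - 1 by omega,
          hU.cyc_eq_precedingLetter hk]
        have : binaryValue (fun l => cyc U (2 ^ k - 1 + 1 + l)) k = 0 := by
          rw [← binaryValue_zero k]
          exact binaryValue_congr fun l hl => hz' _ (by omega) (by omega)
        rw [this, precedingLetter, if_pos]
        unfold Xor; omega
      · congr 1
        · simp only [Function.comp, hpos0, hlast0]
        · refine List.map_congr_left fun b hb => ?_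
          rw [List.mem_range'_1] at hb
          have h0 := hposne b (by omega) (by omega)
          have h1 := hposlt b (by omega)
          simp only [Function.comp]
          rw [hlast _ (by omega) (by omega), hU.cyc_eq_precedingLetter hk]
          congr 2
          rw [← hposval b (by omega), hposval b (by omega)]
          simp only [show pos b - 1 + 1 = pos b by omega]
          exact hposval b (by omega)
  have hruns := numRuns_map_precedingLetter h4 (n := 2 ^ k - 1) (by omega) (by omega)
  rw [show 2 ^ k - (2 ^ k - 1) = 1 by omega] at hruns
  -- Since `k ≥ 2`, the block of zeros is nonempty and counts as a run.
  rw [hbwt, show k - 1 = (k - 2) + 1 by omega,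
    numRuns_replicate_append fun h => zero_ne_one (WithBot.coe_injective h),
    numRuns_cons_cons, if_neg WithBot.coe_ne_bot]
  have hp : 2 ^ k = 2 * 2 ^ (k - 2 + 1) := by
    rw [← pow_succ']; congr 1; omega
  rw [show 2 ^ k - 1 = (2 ^ k - 2) + 1 by omega, List.range'_succ, List.map_cons] at hruns ⊢
  rw [numRuns_cons_cons, if_neg WithBot.bot_ne_coe, hruns]
  omega

end RunMinimal

/-! ### The theorem and its limits. -/

theorem mainTheorem2 :
    -- the values of `χ` and `r` for each admissible degree, whatever the initial state
    (∀ k : ℕ, 2 ≤ k → RunMinimal.IsPrimitiveF2 (RunMinimal.trinomial k) →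
      ∀ seed : Fin k → ZMod 2,
        (∃! U : List (Fin 2), RunMinimal.IsZeroRotation k seed U) ∧
        ∀ U : List (Fin 2), RunMinimal.IsZeroRotation k seed U →
          RunMinimal.chi (RunMinimal.linearize k U) = 2 ^ k + 1 ∧
          RunMinimal.bwtRuns (RunMinimal.linearize k U) = 2 ^ (k - 1) + 4 ∧
          (RunMinimal.chi (RunMinimal.linearize k U) : ℝ) /
              (RunMinimal.bwtRuns (RunMinimal.linearize k U) : ℝ) =
            ((2 : ℝ) ^ k + 1) / ((2 : ℝ) ^ (k - 1) + 4)) ∧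
    -- the closed form tends to `2` along all `k`
    Tendsto (fun k : ℕ => ((2 : ℝ) ^ k + 1) / ((2 : ℝ) ^ (k - 1) + 4)) atTop (𝓝 2) ∧
    -- the ratio itself tends to `2` as `k` grows through the admissible degrees
    (∀ (seed : (k : ℕ) → Fin k → ZMod 2) (U : ℕ → List (Fin 2)),
      (∀ k ∈ RunMinimal.primitiveDegrees, RunMinimal.IsZeroRotation k (seed k) (U k)) →
      Tendsto
        (fun k : ℕ => (RunMinimal.chi (RunMinimal.linearize k (U k)) : ℝ) /
          (RunMinimal.bwtRuns (RunMinimal.linearize k (U k)) : ℝ))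
        (atTop ⊓ 𝓟 RunMinimal.primitiveDegrees) (𝓝 2)) ∧
    -- this last limit is along a proper filter exactly if there are infinitely many such degrees
    ((atTop ⊓ 𝓟 RunMinimal.primitiveDegrees).NeBot ↔ RunMinimal.primitiveDegrees.Infinite) := by
  have hval : ∀ k : ℕ, 2 ≤ k → RunMinimal.IsPrimitiveF2 (RunMinimal.trinomial k) →
      ∀ (seed : Fin k → ZMod 2) (U : List (Fin 2)), RunMinimal.IsZeroRotation k seed U →
        RunMinimal.chi (RunMinimal.linearize k U) = 2 ^ k + 1 ∧
        RunMinimal.bwtRuns (RunMinimal.linearize k U) = 2 ^ (k - 1) + 4 ∧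
        (RunMinimal.chi (RunMinimal.linearize k U) : ℝ) /
            (RunMinimal.bwtRuns (RunMinimal.linearize k U) : ℝ) =
          ((2 : ℝ) ^ k + 1) / ((2 : ℝ) ^ (k - 1) + 4) := by
    intro k hk hT seed U hU
    obtain ⟨h1, h2⟩ := hU.isJoinedDeBruijn hk hT
    have hc := RunMinimal.chi_linearize hk h1 h2
    have hr := RunMinimal.bwtRuns_linearize hk h1 h2
    exact ⟨hc, hr, by rw [hc, hr]; push_cast; rfl⟩
  have hlim : Tendsto (fun k : ℕ => ((2 : ℝ) ^ k + 1) / ((2 : ℝ) ^ (k - 1) + 4)) atTop (𝓝 2) := by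
    -- Shifting by one removes the truncated `k - 1`; dividing by `2^k` then leaves powers of `1/2`.
    rw [← tendsto_add_atTop_iff_nat 1]
    have h0 : Tendsto (fun k : ℕ => ((1 : ℝ) / 2) ^ k) atTop (𝓝 0) :=
      tendsto_pow_atTop_nhds_zero_of_lt_one (by norm_num) (by norm_num)
    have h1 : Tendsto (fun k : ℕ => (2 + ((1 : ℝ) / 2) ^ k) / (1 + 4 * ((1 : ℝ) / 2) ^ k)) atTop
        (𝓝 ((2 + 0) / (1 + 4 * 0))) :=
      (h0.const_add 2).div ((h0.const_mul 4).const_add 1) (by norm_num)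
    simp only [add_zero, mul_zero, div_one] at h1
    refine h1.congr fun k => ?_
    have : (0 : ℝ) < 2 ^ k := by positivity
    rw [Nat.add_sub_cancel, one_div_pow, pow_succ]
    field_simp
  refine ⟨fun k hk hT seed =>
    ⟨RunMinimal.existsUnique_isZeroRotation hk hT seed, hval k hk hT seed⟩, hlim, ?_, ?_⟩
  · intro seed U hU
    refine (hlim.mono_left inf_le_left).congr' ?_
    filter_upwards [mem_inf_of_right (mem_principal_self _)] with k hk
    exact (hval k hk.1 hk.2 (seed k) (U k) (hU k hk)).2.2.symm
  · rw [← frequently_mem_iff_neBot, Nat.frequently_atTop_iff_infinite]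
    rfl
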